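/- Let $F$ be a non-archimedean local field (of arbitrary characteristic), with absolute value $|\cdot|$, extended uniquely to an algebraic closure $k$ of $F$. Let $T$ be an $F$-torus, not necessarily split over $F$, i.e. a linear algebraic group over $F$ with $T_k\cong\mathbb{G}_{m,k}^{\,d}$ for some $d\ge 0$, and let $\chi\in X^*(T)=\operatorname{Hom}_k(T_k,\mathbb{G}_{m,k})$ be a non-trivial character (not necessarily defined over $F$). Then there exists $\varepsilon>0$ such that the function $$t\longmapsto |\chi(t)-1|^{-\varepsilon}$$ on $T(F)$, with value $+\infty$ where $\chi(t)=1$, is locally summable with respect to Haar measure on $T(F)$; that is, it is measurable (up to a null set) and every point of $T(F)$ has a neighbourhood over which its integral is finite. -/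

import Mathlib

open MeasureTheory TensorProduct
open scoped ENNReal

noncomputable section

/-!
Affine group schemes over `F` are given by their coordinate rings, which are commutative Hopf
algebras over `F`.  Base change to an algebraic closure is the tensor product.
-/

/-- The linear algebraic group over `F` with coordinate ring `A` is a torus: over an algebraic
closure of `F` it becomes isomorphic, as a group, to `𝔾ₘ ^ m`, whose coordinate ring is the group
algebra of `ℤ ^ m`, that is, the ring of Laurent polynomials in `m` variables with each variable
group-like. The torus need not be split over `F`. -/
structure IsTorus (F A : Type*) [Field F] [CommRing A] [HopfAlgebra F A] : Prop where
  finiteType : Algebra.FiniteType F A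
  exists_bialgEquiv : ∃ m : ℕ, Nonempty
    (AlgebraicClosure F ⊗[F] A ≃ₐc[AlgebraicClosure F]
      AddMonoidAlgebra (AlgebraicClosure F) (Fin m → ℤ))

/-- The character group `X^*(T)`: the characters `T → 𝔾ₘ` defined over an algebraic closure `k`
of `F`. A homomorphism `T_k → 𝔾ₘ` is a group-like element of the coordinate ring `k ⊗ A`. The
group law is multiplication, and the trivial character is `1`. -/
abbrev CharacterGroup (F A : Type*) [Field F] [CommRing A] [HopfAlgebra F A] :=
  GroupLike (AlgebraicClosure F) (AlgebraicClosure F ⊗[F] A)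

/-- The group `T(F)` of `F`-points: `F`-algebra homomorphisms `A → F`, with the convolution product
`(s * t)(a) = ∑ s(a₁) t(a₂)` where `Δ a = ∑ a₁ ⊗ a₂`. -/
def RationalPoints (F A : Type*) [Field F] [CommRing A] [HopfAlgebra F A] :=
  WithConv (A →ₐ[F] F)

namespace RationalPoints

instance (F A : Type*) [Field F] [CommRing A] [HopfAlgebra F A] : Group (RationalPoints F A) :=
  inferInstanceAs (Group (WithConv (A →ₐ[F] F)))

/-- The topology of `T(F)` induced by that of `F`: the coarsest for which every regular function
`t ↦ a(t)`, `a ∈ A`, is continuous (for `T ⊆ 𝔸ⁿ` closed, the subspace topology from `Fⁿ`). -/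
instance (F A : Type*) [Field F] [TopologicalSpace F] [CommRing A] [HopfAlgebra F A] :
    TopologicalSpace (RationalPoints F A) :=
  TopologicalSpace.induced (fun t (a : A) => t.ofConv a) inferInstance

/-- `T(F)` carries its Borel `σ`-algebra. -/
instance (F A : Type*) [Field F] [TopologicalSpace F] [CommRing A] [HopfAlgebra F A] :
    MeasurableSpace (RationalPoints F A) :=
  borel _

instance (F A : Type*) [Field F] [TopologicalSpace F] [CommRing A] [HopfAlgebra F A] :
    BorelSpace (RationalPoints F A) :=
  ⟨rfl⟩

end RationalPoints

/-- The value `χ(t)` in the algebraic closure `k` of a character `χ` at a point `t ∈ T(F)`: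
the image of `χ` under `k ⊗ A → k`, `c ⊗ a ↦ c * t(a)`. -/
def CharacterGroup.eval {F A : Type*} [Field F] [CommRing A] [HopfAlgebra F A]
    (χ : CharacterGroup F A) (t : RationalPoints F A) : AlgebraicClosure F :=
  Algebra.TensorProduct.lift (AlgHom.id (AlgebraicClosure F) (AlgebraicClosure F))
    ((Algebra.ofId F (AlgebraicClosure F)).comp t.ofConv) (fun _ _ => Commute.all _ _) χ.val

end

/-!
For a Haar measure `μ` on `T(F)` and a compact set `S`, finiteness of the integral of
`|χ - 1| ^ (-ε)` over `S` follows from an estimate `μ (S ∩ {|χ - 1| ≤ c η ^ n}) ≤ B 2 ^ (-n)` with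
`0 < η < 1`: a sum over the shells between consecutive levels is dominated by a geometric series as
soon as `η ^ (-ε) < 2` (`setLIntegral_rpow_neg_lt_top`). The constants `c` and `η` depend neither on
`μ` nor on `S`, so one `ε` serves everywhere.

The sublevel estimate is a packing argument. Let `E = S ∩ {|χ - 1| ≤ δ}`. Suppose that `γ` maps a
ball of `F` into a compact subset of `T(F)`, and that `χ (γ x) = P x / Q x` for distinct
polynomials `P`, `Q` with `P 0 = Q 0 = 1`, both of absolute value `1` on the ball. If a point `g`
lies in the translate `γ x * E`, then `|P x - χ(g) Q x| ≤ δ`. Lagrange interpolation of the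
polynomial `P - χ(g) Q` shows that this can happen for at most `m` points `x` of a `ρ`-separated
set, where `m` bounds the degrees and `δ` is a small multiple of `ρ ^ m`
(`card_le_of_norm_sub_mul_le`). A set of `2 ^ n` points separated by `ρ = ‖ϖ‖ ^ n` is given by the
finite expansions in powers of `ϖ` with digits `0` and `1`. Hence `2 ^ n` translates of `E` cover
each point of one fixed compact set at most `m` times, and no other point, so that
`2 ^ n μ(E) ≤ m μ(compact)` (`exists_measure_sublevel_le`).

It remains to find `γ` (`exists_rational_curve`). Choose a finite normal extension `L / F` over
which all characters are defined, a cocharacter `λ` with `⟨χ, λ⟩ ≠ 0`, and `α ∈ L` nonzero and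
moved by each nontrivial automorphism of `L / F`. The norm `∏ σ (λ (1 - x α))`, over the
automorphisms `σ` of `L / F`, is invariant, so its coordinates lie in a purely inseparable
extension of `F`. On a torus, raising to the power `q = p ^ k`, with `p` the exponential
characteristic, is given by `F`-linear combinations of `q`-th powers of regular functions
(`pow_apply_mem_span`), so for large `k` the `q`-th power of the norm is a point `γ x` of `T(F)`.
Each character takes on it the value `∏ (1 - x σ(α)) ^ (N σ)` for some integers `N σ`; for `χ` the
exponent of `σ = 1` is `q ⟨χ, λ⟩ ≠ 0`, and the `σ(α)` are distinct, so the value is not constant.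
-/

namespace AlgebraicTorus

/-! ### Points and characters -/

section Points

variable {F A : Type*} [Field F] [CommRing A] [HopfAlgebra F A]

/-- The homomorphism `T(R) → T(S)` of groups of points induced by `f : R → S`. -/
noncomputable def mapPoint {R S : Type*} [CommRing R] [Algebra F R] [CommRing S] [Algebra F S]
    (f : R →ₐ[F] S) : WithConv (A →ₐ[F] R) →* WithConv (A →ₐ[F] S) where
  toFun t := .toConv (f.comp t.ofConv)
  map_one' := by
    rw [AlgHom.convOne_def, AlgHom.convOne_def]
    ext a
    simp
  map_mul' s t := by
    rw [AlgHom.comp_convMul_distrib]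

lemma mapPoint_apply {R S : Type*} [CommRing R] [Algebra F R] [CommRing S] [Algebra F S]
    (f : R →ₐ[F] S) (t : WithConv (A →ₐ[F] R)) (a : A) :
    (mapPoint f t).ofConv a = f (t.ofConv a) := rfl

variable {K : Type*} [Field K] [Algebra F K]
variable {R : Type*} [CommRing R] [Algebra F R] [Algebra K R] [IsScalarTower F K R]

/-- Evaluation at a point `t ∈ T(R)` of the regular functions on the base change `T_K`, for a
`K`-algebra `R`. -/
noncomputable def extendPoint (t : WithConv (A →ₐ[F] R)) : K ⊗[F] A →ₐ[K] R :=
  Algebra.TensorProduct.lift (Algebra.ofId K R) t.ofConv fun _ _ => Commute.all _ _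

@[simp]
lemma extendPoint_tmul (t : WithConv (A →ₐ[F] R)) (c : K) (a : A) :
    extendPoint t (c ⊗ₜ[F] a) = algebraMap K R c * t.ofConv a := rfl

/-- Evaluation at a product is convolution with respect to the comultiplication of `K ⊗ A`. -/
lemma extendPoint_mul (s t : WithConv (A →ₐ[F] R)) (x : K ⊗[F] A) :
    extendPoint (s * t) x =
      Algebra.TensorProduct.lift (extendPoint s) (extendPoint t) (fun _ _ => Commute.all _ _)
        (Coalgebra.comul (R := K) x) := by
  induction x with
  | zero => simp
  | add x y hx hy => simp [hx, hy]
  | tmul c a =>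
    have h : (s * t).ofConv a = _ := AlgHom.convMul_apply s t a
    rw [extendPoint_tmul, h]
    simp [← (Coalgebra.Repr.arbitrary F a).eq, TensorProduct.tmul_sum, Finset.mul_sum,
      mul_left_comm]

/-- The homomorphism `T(R) → (R, ·)` given by a character of `T_K`, for a `K`-algebra `R`. -/
noncomputable def charHom (u : GroupLike K (K ⊗[F] A)) : WithConv (A →ₐ[F] R) →* R where
  toFun t := extendPoint t u.val
  map_one' := by
    have h (x : K ⊗[F] A) : extendPoint (1 : WithConv (A →ₐ[F] R)) x =
        algebraMap K R (Coalgebra.counit (R := K) x) := by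
      induction x with
      | zero => simp
      | add x y hx hy => simp [hx, hy]
      | tmul c a =>
        have h : (1 : WithConv (A →ₐ[F] R)).ofConv a = _ := AlgHom.convOne_apply a
        rw [extendPoint_tmul, h, TensorProduct.counit_tmul, Algebra.smul_def, map_mul, mul_comm]
        simp [← IsScalarTower.algebraMap_apply]
    rw [h, u.2.counit_eq_one, map_one]
  map_mul' s t := by
    rw [extendPoint_mul, u.2.comul_eq_tmul_self]
    simp

lemma charHom_apply (u : GroupLike K (K ⊗[F] A)) (t : WithConv (A →ₐ[F] R)) :
    charHom u t = extendPoint t u.val := rfl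

variable (hspan : Submodule.span K (Set.range (GroupLike.val (R := K) (A := K ⊗[F] A))) = ⊤)
include hspan

/-- If the characters span the regular functions, then they separate points. -/
lemma point_ext {s t : WithConv (A →ₐ[F] R)}
    (h : ∀ u : GroupLike K (K ⊗[F] A), charHom u s = charHom u t) : s = t := by
  have : (extendPoint s : K ⊗[F] A →ₐ[K] R).toLinearMap = (extendPoint t).toLinearMap :=
    LinearMap.ext_on hspan (by rintro _ ⟨u, rfl⟩; exact h u)
  ext a
  simpa using congr($this (1 ⊗ₜ a))

lemma point_mul_comm (s t : WithConv (A →ₐ[F] R)) : s * t = t * s :=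
  point_ext hspan fun u => by rw [map_mul, map_mul, mul_comm]

/-- Galois automorphisms permute the characters. The conjugate of a character is multiplicative on
`T(K)` and is a linear combination of characters, so Dedekind's independence of multiplicative
functions makes it one of them. -/
lemma exists_charHom_conj (σ : K ≃ₐ[F] K) (u : GroupLike K (K ⊗[F] A)) :
    ∃ u' : GroupLike K (K ⊗[F] A), ∀ t : WithConv (A →ₐ[F] K),
      charHom u (mapPoint σ.toAlgHom t) = σ (charHom u' t) := by
  let θ : WithConv (A →ₐ[F] K) →* K :=
    ((σ.symm : K →* K).comp (charHom u)).comp (mapPoint σ.toAlgHom)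
  have hθ (x : K ⊗[F] A) (t : WithConv (A →ₐ[F] K)) :
      σ.symm (extendPoint (mapPoint σ.toAlgHom t) x) =
        extendPoint t (Algebra.TensorProduct.map σ.symm.toAlgHom (AlgHom.id F A) x) := by
    induction x with
    | zero => simp
    | add x y hx hy => simp only [map_add, hx, hy]
    | tmul c a =>
      rw [extendPoint_tmul, mapPoint_apply]
      simp
  let Φ : K ⊗[F] A →ₗ[K] (WithConv (A →ₐ[F] K) → K) :=
    LinearMap.pi fun t => (extendPoint t).toLinearMap
  have hmem : (θ : WithConv (A →ₐ[F] K) → K) ∈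
      Submodule.span K ((fun f : WithConv (A →ₐ[F] K) →* K => (f : WithConv (A →ₐ[F] K) → K)) ''
        Set.range (fun v : GroupLike K (K ⊗[F] A) => charHom v)) := by
    have h1 : (θ : WithConv (A →ₐ[F] K) → K) =
        Φ (Algebra.TensorProduct.map σ.symm.toAlgHom (AlgHom.id F A) u.val) := by
      ext t
      exact hθ u.val t
    have h2 : (fun f : WithConv (A →ₐ[F] K) →* K => (f : WithConv (A →ₐ[F] K) → K)) ''
        Set.range (fun v : GroupLike K (K ⊗[F] A) => charHom v) =
        Φ '' Set.range (GroupLike.val (R := K) (A := K ⊗[F] A)) := by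
      rw [← Set.range_comp, ← Set.range_comp]
      rfl
    rw [h1, h2, Submodule.span_image, hspan]
    exact Submodule.mem_map_of_mem Submodule.mem_top
  by_contra! hne
  refine (linearIndependent_monoidHom (WithConv (A →ₐ[F] K)) K).notMem_span_image
    (x := θ) ?_ hmem
  rintro ⟨u', hu'⟩
  obtain ⟨t, ht⟩ := hne u'
  apply ht
  have : charHom u' t = θ t := congr($hu' t)
  rw [this]
  exact (σ.apply_symm_apply _).symm

/-- For `q = p ^ n` the coordinates of `t ^ q` are `F`-linear combinations of `q`-th powers of
coordinates of `t`; this is the factorization of the `q`-power map through the relative Frobenius.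
Over `K` it holds because the characters span, and it descends to `F` by linear algebra. -/
lemma pow_apply_mem_span (p : ℕ) [ExpChar F p] (n : ℕ) {S : Type*} [CommRing S] [Algebra F S]
    (t : WithConv (A →ₐ[F] S)) (a : A) :
    (t ^ p ^ n).ofConv a ∈ Submodule.span F (Set.range fun b => t.ofConv b ^ p ^ n) := by
  have : ExpChar K p := expChar_of_injective_algebraMap (algebraMap F K).injective p
  have : Nontrivial (K ⊗[F] A) :=
    (Bialgebra.counitAlgHom K (K ⊗[F] A)).toRingHom.domain_nontrivial
  set q := p ^ n with hq
  -- the universal case: `t` is the identity of `A`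
  let β : WithConv (A →ₐ[F] A) := WithConv.toConv (AlgHom.id F A) ^ q
  have key : β.ofConv a ∈ Submodule.span F (Set.range fun b : A => b ^ q) := by
    let ι : WithConv (A →ₐ[F] K ⊗[F] A) := .toConv Algebra.TensorProduct.includeRight
    have hι (x : K ⊗[F] A) : extendPoint (K := K) ι x = x := by
      induction x with
      | zero => simp
      | add x y hx hy => simp [hx, hy]
      | tmul c a => simp [ι]
    have hιq : ι ^ q = mapPoint Algebra.TensorProduct.includeRight β := by
      rw [map_pow]
      rfl
    have h1 (x : K ⊗[F] A) : extendPoint (K := K) (ι ^ q) x ∈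
        Submodule.span K (Set.range fun b : A => (1 : K) ⊗ₜ[F] (b ^ q)) := by
      have hx : x ∈ Submodule.span K (Set.range (GroupLike.val (R := K) (A := K ⊗[F] A))) :=
        hspan ▸ Submodule.mem_top
      induction hx using Submodule.span_induction with
      | zero => simp
      | add x y _ _ hx hy => rw [map_add]; exact add_mem hx hy
      | smul c x _ hx => rw [map_smul]; exact Submodule.smul_mem _ _ hx
      | mem x hx =>
        obtain ⟨u, rfl⟩ := hx
        have : extendPoint (K := K) (ι ^ q) u.val = u.val ^ q := by
          rw [← charHom_apply, map_pow, charHom_apply, hι]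
        rw [this]
        generalize u.val = y
        have : ExpChar (K ⊗[F] A) p := expChar_of_injective_algebraMap
          (algebraMap K (K ⊗[F] A)).injective p
        induction y with
        | zero =>
          rw [zero_pow (pow_ne_zero _ (expChar_pos F p).ne')]; exact zero_mem _
        | add x y hx hy => rw [hq, add_pow_expChar_pow]; exact add_mem hx hy
        | tmul c a =>
          rw [Algebra.TensorProduct.tmul_pow, ← mul_one (c ^ q), ← smul_eq_mul,
            ← TensorProduct.smul_tmul']
          exact Submodule.smul_mem _ _ (Submodule.subset_span ⟨a, rfl⟩)
    have h2 : (1 : K) ⊗ₜ[F] β.ofConv a ∈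
        Submodule.span K (Set.range fun b : A => (1 : K) ⊗ₜ[F] (b ^ q)) := by
      have := h1 (1 ⊗ₜ a)
      rwa [hιq, extendPoint_tmul, map_one, one_mul] at this
    -- an `F`-linear retraction `K → F` carries the combination over `K` to one over `F`
    obtain ⟨π, hπ⟩ := LinearMap.exists_leftInverse_of_injective (Algebra.linearMap F K)
      (LinearMap.ker_eq_bot.2 (algebraMap F K).injective)
    have hπ1 : π 1 = 1 := by simpa using congr($hπ 1)
    let retr : K ⊗[F] A →ₗ[F] A := (TensorProduct.lid F A).toLinearMap ∘ₗ π.rTensor A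
    have hretr (x : K ⊗[F] A)
        (hx : x ∈ Submodule.span K (Set.range fun b : A => (1 : K) ⊗ₜ[F] (b ^ q))) :
        retr x ∈ Submodule.span F (Set.range fun b : A => b ^ q) := by
      rw [Finsupp.mem_span_range_iff_exists_finsupp] at hx
      obtain ⟨c, rfl⟩ := hx
      rw [Finsupp.sum, map_sum]
      refine sum_mem fun b _ => ?_
      have : retr (c b • (1 : K) ⊗ₜ[F] (b ^ q)) = π (c b) • b ^ q := by
        simp [retr, TensorProduct.smul_tmul']
      rw [this]
      exact Submodule.smul_mem _ _ (Submodule.subset_span ⟨b, rfl⟩)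
    have := hretr _ h2
    simpa [retr, hπ1] using this
  have ht : t ^ q = mapPoint t.ofConv β := by
    rw [map_pow]
    rfl
  rw [ht, mapPoint_apply]
  have := Submodule.mem_map_of_mem (f := t.ofConv.toLinearMap) key
  rw [Submodule.map_span, ← Set.range_comp] at this
  simpa [Function.comp_def] using this

end Points

/-! ### Finite normal extensions -/

section FieldTheory

/-- The elements of `L` fixed by all automorphisms form a purely inseparable extension of `F`, of
finite exponent. -/
lemma exists_pow_mem_range_of_fixed (F L : Type*) [Field F] [Field L] [Algebra F L]
    [FiniteDimensional F L] [Normal F L] (p : ℕ) [ExpChar F p] :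
    ∃ n : ℕ, ∀ b : L, (∀ σ : L ≃ₐ[F] L, σ b = b) → b ^ p ^ n ∈ (algebraMap F L).range := by
  obtain ⟨n, hn⟩ := (IsPurelyInseparable.hasExponent_iff' F (perfectClosure F L) p).1 inferInstance
  refine ⟨n, fun b hb => ?_⟩
  have hbmem : b ∈ perfectClosure F L := by
    classical
    rw [mem_perfectClosure_iff_natSepDegree_eq_one,
      Polynomial.natSepDegree_eq_of_splits _ (E := L) (Normal.splits inferInstance b),
      Finset.card_eq_one]
    refine ⟨b, ?_⟩
    ext y
    have hne : minpoly F b ≠ 0 := minpoly.ne_zero (Algebra.IsIntegral.isIntegral b)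
    rw [Multiset.mem_toFinset, Polynomial.mem_aroots, Finset.mem_singleton]
    constructor
    · rintro ⟨-, hy⟩
      obtain ⟨σ, rfl⟩ := minpoly.exists_algEquiv_of_root' (Algebra.IsAlgebraic.isAlgebraic b) hy
      exact hb σ
    · rintro rfl
      exact ⟨hne, minpoly.aeval F y⟩
  obtain ⟨c, hc⟩ := hn ⟨b, hbmem⟩
  exact ⟨c, congrArg Subtype.val hc⟩

/-- The fixed spaces of the nontrivial automorphisms are finitely many proper subspaces, so they do
not cover `L`. Separability is not needed. -/
lemma exists_ne_zero_forall_apply_ne (F L : Type*) [Field F] [Infinite F] [Field L] [Algebra F L]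
    [FiniteDimensional F L] :
    ∃ α : L, α ≠ 0 ∧ ∀ σ : L ≃ₐ[F] L, σ ≠ 1 → σ α ≠ α := by
  classical
  by_contra! h
  -- the zero subspace, placed at the index `1`, accounts for the condition `α ≠ 0`
  let p (σ : L ≃ₐ[F] L) : Subspace F L :=
    if σ = 1 then ⊥ else LinearMap.eqLocus σ.toLinearMap LinearMap.id
  obtain ⟨σ, hσ⟩ := Subspace.exists_eq_top_of_iUnion_eq_univ (p := p) <| by
    refine Set.eq_univ_of_forall fun α => Set.mem_iUnion.2 ?_
    by_cases hα : α = 0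
    · exact ⟨1, by simp [hα]⟩
    · obtain ⟨σ, h1, h2⟩ := h α hα
      exact ⟨σ, by simpa [p, h1] using h2⟩
  by_cases h1 : σ = 1
  · simp [p, h1] at hσ
  · simp only [p, h1, if_false] at hσ
    exact h1 (AlgEquiv.ext fun x => by
      have hx : x ∈ LinearMap.eqLocus σ.toLinearMap (LinearMap.id : L →ₗ[F] L) :=
        hσ ▸ Submodule.mem_top
      exact hx)

end FieldTheory

/-! ### Rational curves on a torus -/

section Torus

universe u v
variable {F : Type u} {A : Type v} [Field F] [CommRing A] [HopfAlgebra F A]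

lemma span_groupLike_eq_top (hT : IsTorus F A) :
    Submodule.span (AlgebraicClosure F) (Set.range (GroupLike.val (R := AlgebraicClosure F)
      (A := AlgebraicClosure F ⊗[F] A))) = ⊤ := by
  obtain ⟨m, ⟨e⟩⟩ := hT.exists_bialgEquiv
  have h := AddMonoidAlgebra.span_isGroupLikeElem (R := AlgebraicClosure F)
    (A := AlgebraicClosure F) (G := Fin m → ℤ)
  rw [eq_top_iff]
  intro x _
  have hx : e x ∈ Submodule.span (AlgebraicClosure F)
      {a : AddMonoidAlgebra (AlgebraicClosure F) (Fin m → ℤ) |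
        IsGroupLikeElem (AlgebraicClosure F) a} := h ▸ Submodule.mem_top
  have := Submodule.mem_map_of_mem (f := (e.symm : AddMonoidAlgebra (AlgebraicClosure F)
    (Fin m → ℤ) →ₐc[AlgebraicClosure F] AlgebraicClosure F ⊗[F] A).toLinearMap) hx
  rw [Submodule.map_span] at this
  have hex : (e.symm : AddMonoidAlgebra (AlgebraicClosure F)
    (Fin m → ℤ) →ₐc[AlgebraicClosure F] AlgebraicClosure F ⊗[F] A).toLinearMap (e x) = x :=
    e.symm_apply_apply x
  rw [hex] at this
  refine Submodule.span_mono ?_ this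
  rintro _ ⟨a, ha, rfl⟩
  exact ⟨⟨_, IsGroupLikeElem.map e.symm ha⟩, rfl⟩

/-- A cocharacter `z ↦ t` of the torus over the algebraic closure, recorded through its pairing `n`
with characters, that pairs nontrivially with `χ`. -/
lemma exists_cocharacter (hT : IsTorus F A) {χ : CharacterGroup F A} (hχ : χ ≠ 1) :
    ∃ n : CharacterGroup F A → ℤ, n χ ≠ 0 ∧ ∀ z : AlgebraicClosure F, z ≠ 0 →
      ∃ t : WithConv (A →ₐ[F] AlgebraicClosure F), ∀ u, charHom u t = z ^ n u := by
  obtain ⟨m, ⟨e⟩⟩ := hT.exists_bialgEquiv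
  have hmon (u : CharacterGroup F A) : ∃ v : Fin m → ℤ, e u.val = AddMonoidAlgebra.single v 1 := by
    have : IsGroupLikeElem (AlgebraicClosure F) (e u.val) := IsGroupLikeElem.map e u.2
    obtain ⟨v, hv⟩ := AddMonoidAlgebra.isGroupLikeElem_iff_mem_range_of.1 this
    exact ⟨v.toAdd, hv.symm⟩
  choose v hv using hmon
  have hvχ : v χ ≠ 0 := by
    intro h0
    apply hχ
    apply GroupLike.val_injective
    refine EquivLike.injective e ?_
    rw [hv, h0, GroupLike.val_one, map_one]
    rfl
  obtain ⟨i, hi⟩ := Function.ne_iff.1 hvχ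
  refine ⟨fun u => v u i, hi, fun z hz => ?_⟩
  let f : Multiplicative (Fin m → ℤ) →* AlgebraicClosure F :=
    { toFun w := z ^ (w.toAdd i)
      map_one' := by simp
      map_mul' a b := by simp [zpow_add₀ hz] }
  let g : AlgebraicClosure F ⊗[F] A →ₐ[AlgebraicClosure F] AlgebraicClosure F :=
    (AddMonoidAlgebra.lift _ _ _ f).comp (e : _ ≃ₐ[AlgebraicClosure F] _).toAlgHom
  let t : WithConv (A →ₐ[F] AlgebraicClosure F) :=
    .toConv ((g.restrictScalars F).comp Algebra.TensorProduct.includeRight)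
  have htg : extendPoint (K := AlgebraicClosure F) t = g := by
    ext a
    simp [t]
  refine ⟨t, fun u => ?_⟩
  rw [charHom_apply, htg]
  have : g u.val = AddMonoidAlgebra.lift _ _ _ f (e u.val) := rfl
  rw [this, hv, AddMonoidAlgebra.lift_single, one_smul]
  rfl

/-- A finite normal extension `L` of `F` over which all characters are jointly defined: a point at
which all characters take values in `L` is defined over `L`. -/
lemma exists_normal_forall_apply_mem (hT : IsTorus F A) :
    ∃ L : IntermediateField F (AlgebraicClosure F), FiniteDimensional F L ∧ Normal F L ∧
      ∀ t : WithConv (A →ₐ[F] AlgebraicClosure F),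
        (∀ u : CharacterGroup F A, charHom u t ∈ L) → ∀ a, t.ofConv a ∈ L := by
  classical
  obtain ⟨s, hs⟩ := hT.finiteType.out
  have hc (a : A) : ∃ c : CharacterGroup F A →₀ AlgebraicClosure F,
      c.sum (fun u x => x • u.val) = (1 : AlgebraicClosure F) ⊗ₜ[F] a :=
    Finsupp.mem_span_range_iff_exists_finsupp.1 (span_groupLike_eq_top hT ▸ Submodule.mem_top)
  choose c hc using hc
  let S : Finset (AlgebraicClosure F) := s.biUnion fun a => (c a).support.image (c a)
  let E := IntermediateField.adjoin F (S : Set (AlgebraicClosure F))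
  have hE : FiniteDimensional F E :=
    IntermediateField.finiteDimensional_adjoin fun x _ => Algebra.IsIntegral.isIntegral x
  refine ⟨IntermediateField.normalClosure F E (AlgebraicClosure F), inferInstance, inferInstance,
    fun t ht => ?_⟩
  set L := IntermediateField.normalClosure F E (AlgebraicClosure F)
  have hEL : E ≤ L := IntermediateField.le_normalClosure E
  have hle : Algebra.adjoin F (s : Set A) ≤ L.toSubalgebra.comap t.ofConv := by
    refine Algebra.adjoin_le fun a ha => ?_
    have hta : t.ofConv a = extendPoint (K := AlgebraicClosure F) t (1 ⊗ₜ a) := by simp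
    change t.ofConv a ∈ L
    rw [hta, ← hc a, Finsupp.sum, map_sum]
    refine sum_mem fun u hu => ?_
    rw [map_smul, smul_eq_mul]
    refine mul_mem (hEL (IntermediateField.subset_adjoin _ _ ?_)) (ht u)
    exact Finset.mem_biUnion.2 ⟨a, ha, Finset.mem_image_of_mem _ hu⟩
  intro a
  exact hle (hs ▸ Algebra.mem_top)

/-- A family of `F`-points of the torus, parametrized by `x ∈ F`, on which each character is a
product of powers of the distinct linear polynomials `1 - x β i`, and `χ` is not constant. The
parameters `β i` are the conjugates of one element of a finite normal extension of `F`. -/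
theorem exists_rational_curve [Infinite F] (hT : IsTorus F A) {χ : CharacterGroup F A}
    (hχ : χ ≠ 1) :
    ∃ (ι : Type u) (_ : Fintype ι) (β : ι → AlgebraicClosure F)
      (N : ι → CharacterGroup F A → ℤ),
      Function.Injective β ∧ (∀ i, β i ≠ 0) ∧ (∃ i, N i χ ≠ 0) ∧
      ∀ x : F, (∀ i, 1 - algebraMap F (AlgebraicClosure F) x * β i ≠ 0) →
        ∃ t : WithConv (A →ₐ[F] F), ∀ u : CharacterGroup F A,
          charHom u (mapPoint (Algebra.ofId F (AlgebraicClosure F)) t) =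
            ∏ i, (1 - algebraMap F (AlgebraicClosure F) x * β i) ^ N i u := by
  classical
  have hspan := span_groupLike_eq_top hT
  obtain ⟨L, hfin, hnormal, hL⟩ := exists_normal_forall_apply_mem hT
  obtain ⟨n, hnχ, hn⟩ := exists_cocharacter hT hχ
  obtain ⟨α, hα0, hα⟩ := exists_ne_zero_forall_apply_ne F L
  let p := ringExpChar F
  obtain ⟨k, hk⟩ := exists_pow_mem_range_of_fixed F L p
  -- the identity is lifted to the identity, so that `χ` corresponds to itself at `σ = 1`
  have hlift (σ : L ≃ₐ[F] L) : ∃ τ : AlgebraicClosure F ≃ₐ[F] AlgebraicClosure F,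
      (∀ l : L, τ l = σ l) ∧ ∃ f : CharacterGroup F A → CharacterGroup F A,
        (∀ u t, charHom u (mapPoint τ.toAlgHom t) = τ (charHom (f u) t)) ∧ (σ = 1 → f = id) := by
    by_cases h1 : σ = 1
    · subst h1
      exact ⟨1, fun _ => rfl, id, fun _ _ => rfl, fun _ => rfl⟩
    · refine ⟨σ.liftNormal (AlgebraicClosure F), fun l => σ.liftNormal_commutes _ l, ?_⟩
      choose f hf using exists_charHom_conj hspan (σ.liftNormal (AlgebraicClosure F))
      exact ⟨f, hf, fun h => absurd h h1⟩
  choose τ hτ f hf hf1 using hlift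
  have hq : p ^ k ≠ 0 := pow_ne_zero _ (expChar_pos F p).ne'
  refine ⟨L ≃ₐ[F] L, inferInstance, fun σ => σ α, fun σ u => n (f σ u) * (p ^ k : ℕ), ?_, ?_,
    ⟨1, ?_⟩, fun x hx => ?_⟩
  · intro σ σ' h
    by_contra hne
    refine hα (σ'⁻¹ * σ) (fun h1 => hne (inv_mul_eq_one.1 h1).symm) ?_
    have h' : σ α = σ' α := Subtype.ext h
    rw [AlgEquiv.mul_apply, h', ← AlgEquiv.mul_apply, inv_mul_cancel, AlgEquiv.one_apply]
  · intro σ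
    simpa using hα0
  · change n (f 1 χ) * _ ≠ 0
    rw [hf1 1 rfl]
    exact mul_ne_zero hnχ (by exact_mod_cast hq)
  -- the value `z` of the parameter, and the `L`-point `s` it defines through the cocharacter
  let z : L := 1 - algebraMap F L x * α
  have hz : (z : AlgebraicClosure F) ≠ 0 := hx 1
  obtain ⟨s₀, hs₀⟩ := hn z hz
  let s : WithConv (A →ₐ[F] L) := .toConv (s₀.ofConv.codRestrict L.toSubalgebra
    (hL s₀ fun u => hs₀ u ▸ zpow_mem z.2 _))
  have hs : mapPoint L.val s = s₀ := rfl
  have hinj : Function.Injective (mapPoint L.val :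
      WithConv (A →ₐ[F] L) → WithConv (A →ₐ[F] AlgebraicClosure F)) := by
    intro a b hab
    ext y
    exact congr($(hab).ofConv y)
  let _ : CommMonoid (WithConv (A →ₐ[F] L)) :=
    { (inferInstance : Monoid (WithConv (A →ₐ[F] L))) with
      mul_comm a b := hinj (by rw [map_mul, map_mul, point_mul_comm hspan]) }
  -- the norm of `s`
  let c : WithConv (A →ₐ[F] L) := ∏ σ : L ≃ₐ[F] L, mapPoint σ.toAlgHom s
  have hc (σ : L ≃ₐ[F] L) : mapPoint σ.toAlgHom c = c := by
    rw [map_prod]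
    exact Fintype.prod_equiv (Equiv.mulLeft σ) _ _ fun _ => rfl
  have hd (a : A) : (c ^ p ^ k).ofConv a ∈ (⊥ : Subalgebra F L) := by
    have h := pow_apply_mem_span hspan p k c a
    refine (Submodule.span_le (p := Subalgebra.toSubmodule (⊥ : Subalgebra F L))).2 ?_ h
    rintro _ ⟨b, rfl⟩
    exact hk _ fun σ => congr($(hc σ).ofConv b)
  -- the `q`-th power of the norm descends to an `F`-point
  let t : WithConv (A →ₐ[F] F) := .toConv
    ((Algebra.botEquiv F L).toAlgHom.comp ((c ^ p ^ k).ofConv.codRestrict ⊥ hd))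
  have ht : mapPoint (Algebra.ofId F L) t = c ^ p ^ k := by
    ext a
    have : algebraMap F (⊥ : Subalgebra F L) (t.ofConv a) = ⟨(c ^ p ^ k).ofConv a, hd a⟩ :=
      (Algebra.botEquiv F L).symm_apply_apply _
    have h := congrArg Subtype.val this
    exact congrArg Subtype.val h
  refine ⟨t, fun u => ?_⟩
  have h1 : mapPoint (Algebra.ofId F (AlgebraicClosure F)) t =
      mapPoint L.val (mapPoint (Algebra.ofId F L) t) := by
    ext a
    simp [mapPoint_apply, Algebra.ofId_apply]
  have h2 (σ : L ≃ₐ[F] L) : mapPoint L.val (mapPoint σ.toAlgHom s) =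
      mapPoint (τ σ).toAlgHom s₀ := by
    ext a
    exact (hτ σ _).symm
  have h3 : charHom u (mapPoint L.val c) =
      ∏ σ : L ≃ₐ[F] L, charHom u (mapPoint L.val (mapPoint σ.toAlgHom s)) :=
    map_prod ((charHom u).comp (mapPoint L.val)) _ _
  rw [h1, ht, map_pow, map_pow, h3, ← Finset.prod_pow]
  refine Finset.prod_congr rfl fun σ _ => ?_
  rw [h2, hf, hs₀, map_zpow₀, hτ, zpow_mul, zpow_natCast]
  simp [z]

end Torus

/-! ### Separated points and polynomials -/

section Counting

open Polynomial

variable {K : Type*} [NormedField K] [IsUltrametricDist K]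

/-- A polynomial of degree at most `m` that is small at `m + 1` separated points of the unit ball is
small on the unit ball, by Lagrange interpolation. -/
lemma norm_eval_le_of_separated {W : K[X]} {s : Finset K} {m : ℕ} (hs : s.card = m + 1)
    (hW : W.natDegree ≤ m) {ρ δ : ℝ} (hρ : 0 < ρ) (hδ : 0 ≤ δ) (hs1 : ∀ x ∈ s, ‖x‖ ≤ 1)
    (hsep : ∀ x ∈ s, ∀ y ∈ s, x ≠ y → ρ ≤ ‖x - y‖) (hWs : ∀ x ∈ s, ‖W.eval x‖ ≤ δ)
    {y : K} (hy : ‖y‖ ≤ 1) : ‖W.eval y‖ ≤ δ * (ρ ^ m)⁻¹ := by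
  classical
  have hdeg : W.degree < s.card := by
    rw [hs]
    exact (degree_le_of_natDegree_le hW).trans_lt (by exact_mod_cast Nat.lt_succ_self m)
  have hW' := Lagrange.eq_interpolate (v := id) (Set.injOn_id _) hdeg
  rw [hW', Lagrange.interpolate_apply, eval_finsetSum]
  refine IsUltrametricDist.norm_sum_le_of_forall_le_of_nonneg (by positivity) fun x hx => ?_
  rw [eval_mul, eval_C, norm_mul]
  refine mul_le_mul (hWs x hx) ?_ (norm_nonneg _) hδ
  have hcard : (s.erase x).card = m := by rw [Finset.card_erase_of_mem hx, hs]; rfl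
  rw [Lagrange.basis, eval_prod, norm_prod, ← inv_pow, ← hcard, ← Finset.prod_const]
  refine Finset.prod_le_prod (fun _ _ => norm_nonneg _) fun z hz => ?_
  obtain ⟨hzx, hz⟩ := Finset.mem_erase.1 hz
  simp only [Lagrange.basisDivisor, id, eval_mul, eval_C, eval_sub, eval_X, norm_mul, norm_inv]
  have h1 : ‖y - z‖ ≤ 1 := by
    rw [sub_eq_add_neg]
    exact (IsUltrametricDist.norm_add_le_max _ _).trans (by simp [hy, hs1 z hz])
  have h2 : ‖x - z‖⁻¹ ≤ ρ⁻¹ := inv_anti₀ hρ (hsep x hx z hz hzx.symm)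
  calc ‖x - z‖⁻¹ * ‖y - z‖ ≤ ρ⁻¹ * 1 := mul_le_mul h2 h1 (norm_nonneg _) (by positivity)
    _ = ρ⁻¹ := mul_one _

/-- If `P` and `Q` agree at `0` and differ at `y`, then `P / Q` cannot be `δ`-close to one value `u`
at more than `m` separated points: interpolation at `0` bounds `‖1 - u‖`, and then interpolation at
`y` bounds `‖P y - Q y‖`. -/
lemma card_le_of_norm_sub_mul_le {P Q : K[X]} {m : ℕ} (hP : P.natDegree ≤ m)
    (hQ : Q.natDegree ≤ m) (hP0 : P.eval 0 = 1) (hQ0 : Q.eval 0 = 1) {y : K} (hy : ‖y‖ ≤ 1)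
    (hQy : ‖Q.eval y‖ ≤ 1) {ρ δ : ℝ} (hρ : 0 < ρ) (hδ : 0 ≤ δ)
    (hδρ : δ < ‖P.eval y - Q.eval y‖ * ρ ^ m) {s : Finset K} (hs1 : ∀ x ∈ s, ‖x‖ ≤ 1)
    (hsep : ∀ x ∈ s, ∀ y ∈ s, x ≠ y → ρ ≤ ‖x - y‖) (u : K)
    (hu : ∀ x ∈ s, ‖P.eval x - u * Q.eval x‖ ≤ δ) : s.card ≤ m := by
  by_contra! hcard
  obtain ⟨s', hs's, hs'⟩ := Finset.exists_subset_card_eq (Nat.succ_le_of_lt hcard)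
  have hW : (P - C u * Q).natDegree ≤ m :=
    (natDegree_sub_le _ _).trans (max_le hP ((natDegree_C_mul_le _ _).trans hQ))
  have key {z : K} (hz : ‖z‖ ≤ 1) : ‖P.eval z - u * Q.eval z‖ ≤ δ * (ρ ^ m)⁻¹ := by
    have := norm_eval_le_of_separated hs' hW hρ hδ (fun x hx => hs1 x (hs's hx))
      (fun x hx y hy => hsep x (hs's hx) y (hs's hy))
      (fun x hx => by simpa using hu x (hs's hx)) hz
    simpa using this
  have h0 : ‖1 - u‖ ≤ δ * (ρ ^ m)⁻¹ := by simpa [hP0, hQ0] using key (z := 0) (by simp)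
  have h1 : P.eval y - Q.eval y = (P.eval y - u * Q.eval y) + -((1 - u) * Q.eval y) := by ring
  have h2 : ‖P.eval y - Q.eval y‖ ≤ δ * (ρ ^ m)⁻¹ := by
    rw [h1]
    refine (IsUltrametricDist.norm_add_le_max _ _).trans (max_le (key hy) ?_)
    rw [norm_neg, norm_mul]
    exact (mul_le_of_le_one_right (norm_nonneg _) hQy).trans h0
  rw [← div_eq_mul_inv, le_div_iff₀ (by positivity)] at h2
  exact absurd hδρ (not_lt.2 h2)

/-- The `2 ^ n` sums of distinct terms among `ϖ, ϖ ^ 2, …, ϖ ^ n` are separated by `‖ϖ‖ ^ n`. -/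
lemma exists_separated_finset {ϖ : K} (h0 : ϖ ≠ 0) (h1 : ‖ϖ‖ < 1) (n : ℕ) :
    ∃ D : Finset K, D.card = 2 ^ n ∧ (∀ x ∈ D, ‖x‖ ≤ ‖ϖ‖) ∧
      ∀ x ∈ D, ∀ y ∈ D, x ≠ y → ‖ϖ‖ ^ n ≤ ‖x - y‖ := by
  classical
  have hpos : 0 < ‖ϖ‖ := norm_pos_iff.2 h0
  induction n with
  | zero => exact ⟨{0}, by simp, by simp, by simp⟩
  | succ n ih =>
    obtain ⟨D, hcard, hD, hsep⟩ := ih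
    have hone {z : K} (hz : ‖z‖ < 1) : ‖1 + z‖ = 1 := by
      rw [IsUltrametricDist.norm_add_eq_max_of_norm_ne_norm (by simpa using hz.ne')]
      simpa using hz.le
    have hdiff {x y : K} (hx : x ∈ D) (hy : y ∈ D) : ‖x - y‖ < 1 := by
      rw [sub_eq_add_neg]
      refine (IsUltrametricDist.norm_add_le_max _ _).trans_lt (max_lt ?_ ?_)
      · exact (hD x hx).trans_lt h1
      · rw [norm_neg]
        exact (hD y hy).trans_lt h1
    -- points with different first digits are at distance exactly `‖ϖ‖`
    have hcross {x y : K} (hx : x ∈ D) (hy : y ∈ D) : ‖ϖ * (1 + x) - ϖ * y‖ = ‖ϖ‖ := by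
      rw [← mul_sub, norm_mul, add_sub_assoc, hone (hdiff hx hy), mul_one]
    have hle : ‖ϖ‖ ^ (n + 1) ≤ ‖ϖ‖ := pow_le_of_le_one hpos.le h1.le (by simp)
    have hinj0 : Function.Injective fun x : K => ϖ * x := mul_right_injective₀ h0
    have hinj1 : Function.Injective fun x : K => ϖ * (1 + x) :=
      (mul_right_injective₀ h0).comp (add_right_injective 1)
    refine ⟨D.image (fun x => ϖ * x) ∪ D.image (fun x => ϖ * (1 + x)), ?_, ?_, ?_⟩
    · rw [Finset.card_union_of_disjoint, Finset.card_image_of_injective _ hinj0,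
        Finset.card_image_of_injective _ hinj1, hcard, pow_succ, mul_two]
      rw [Finset.disjoint_left]
      intro z hz hz'
      obtain ⟨y, hy, rfl⟩ := Finset.mem_image.1 hz
      obtain ⟨x, hx, hxy⟩ := Finset.mem_image.1 hz'
      have := hcross hx hy
      rw [hxy, sub_self, norm_zero] at this
      exact hpos.ne this
    · intro z hz
      rcases Finset.mem_union.1 hz with hz | hz <;> obtain ⟨x, hx, rfl⟩ := Finset.mem_image.1 hz
      · rw [norm_mul]
        exact mul_le_of_le_one_right hpos.le ((hD x hx).trans h1.le)
      · rw [norm_mul, hone ((hD x hx).trans_lt h1), mul_one]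
    · intro z hz z' hz' hne
      rcases Finset.mem_union.1 hz with hz | hz <;> obtain ⟨x, hx, rfl⟩ := Finset.mem_image.1 hz <;>
        rcases Finset.mem_union.1 hz' with hz' | hz' <;>
        obtain ⟨y, hy, rfl⟩ := Finset.mem_image.1 hz'
      · rw [← mul_sub, norm_mul, pow_succ']
        exact mul_le_mul_of_nonneg_left (hsep x hx y hy fun h => hne (h ▸ rfl)) hpos.le
      · rw [norm_sub_rev, hcross hy hx]
        exact hle
      · rw [hcross hx hy]
        exact hle
      · rw [← mul_sub, add_sub_add_left_eq_sub, norm_mul, pow_succ']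
        exact mul_le_mul_of_nonneg_left (hsep x hx y hy fun h => hne (h ▸ rfl)) hpos.le

end Counting

/-! ### Packing and integrals over shells -/

section Measure

/-- Packing bound: translates of `E` that lie in `C` and cover each point at most `m` times have
total measure at most `m μ(C)`. -/
lemma card_mul_measure_le {G : Type*} [Group G] [MeasurableSpace G] [MeasurableMul G]
    (μ : Measure G) [μ.IsMulLeftInvariant] {E C : Set G} (hE : MeasurableSet E)
    {κ : Type*} (D : Finset κ) (c : κ → G) (hC : ∀ x ∈ D, ∀ g ∈ E, c x * g ∈ C) (m : ℕ)
    (hm : ∀ g : G, ∀ D' ⊆ D, (∀ x ∈ D', (c x)⁻¹ * g ∈ E) → D'.card ≤ m) :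
    D.card * μ E ≤ m * μ C := by
  classical
  let T (x : κ) : Set G := (fun g => (c x)⁻¹ * g) ⁻¹' E
  have hT (x : κ) : MeasurableSet (T x) := measurable_const_mul _ hE
  have hTμ (x : κ) : μ (T x) = μ E := measure_preimage_mul μ _ E
  calc (D.card : ℝ≥0∞) * μ E = ∑ x ∈ D, ∫⁻ g, (T x).indicator 1 g ∂μ := by
        simp [lintegral_indicator_one (hT _), hTμ]
    _ = ∫⁻ g, ∑ x ∈ D, (T x).indicator 1 g ∂μ :=
        (lintegral_finsetSum _ fun x _ => measurable_one.indicator (hT x)).symm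
    _ ≤ ∫⁻ g, (toMeasurable μ C).indicator (fun _ => (m : ℝ≥0∞)) g ∂μ := by
        refine lintegral_mono fun g => ?_
        have hsum : ∑ x ∈ D, (T x).indicator (1 : G → ℝ≥0∞) g =
            ((D.filter fun x => g ∈ T x).card : ℝ≥0∞) := by
          simp [Set.indicator_apply]
        rw [hsum]
        by_cases hg : g ∈ toMeasurable μ C
        · rw [Set.indicator_of_mem hg]
          exact Nat.cast_le.2 <| hm g _ (Finset.filter_subset _ _) fun x hx =>
            (Finset.mem_filter.1 hx).2
        · have : D.filter (fun x => g ∈ T x) = ∅ := by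
            refine Finset.filter_eq_empty_iff.2 fun x hx hgx => hg (subset_toMeasurable μ C ?_)
            simpa using hC x hx _ hgx
          simp [this]
    _ = m * μ C := by
        rw [lintegral_indicator_const (measurableSet_toMeasurable μ C), measure_toMeasurable]

/-- If the measure of the sublevel sets of `f` decays geometrically, then a small negative power of
`f` is integrable. The value `∞` is taken only where `f` vanishes, which is a null set. -/
lemma setLIntegral_rpow_neg_lt_top {X : Type*} [MeasurableSpace X] {μ : Measure X} {S : Set X}
    (hS : μ S ≠ ∞) {f : X → ℝ} (hf : Measurable f) {c η ε : ℝ} (hc : 0 < c)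
    (hη : 0 < η) (hη1 : η < 1) (hε : 0 < ε) (hηε : η ^ (-ε) ≤ 3 / 2) {B : ℝ≥0∞} (hB : B ≠ ∞)
    (h : ∀ n : ℕ, μ (S ∩ {x | f x ≤ c * η ^ n}) ≤ B * (2⁻¹) ^ n) :
    ∫⁻ x in S, ENNReal.ofReal (f x) ^ (-ε) ∂μ < ∞ := by
  set a : ℝ≥0∞ := ENNReal.ofReal ((c * η) ^ (-ε))
  set E : ℕ → Set X := fun n => {x | f x ≤ c * η ^ n}
  have hE (n : ℕ) : MeasurableSet (E n) := measurableSet_le hf measurable_const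
  have hESn (n : ℕ) : μ.restrict S (E n) ≤ B * (2⁻¹) ^ n := by
    rw [Measure.restrict_apply (hE n), Set.inter_comm]
    exact h n
  have hnull : μ.restrict S {x | f x ≤ 0} = 0 := by
    have hlim : Filter.Tendsto (fun n : ℕ => B * (2⁻¹ : ℝ≥0∞) ^ n) Filter.atTop (nhds 0) := by
      have := ENNReal.Tendsto.const_mul (a := B)
        (ENNReal.tendsto_pow_atTop_nhds_zero_of_lt_one (r := 2⁻¹) (by simp)) (Or.inr hB)
      simpa using this
    refine le_antisymm (ge_of_tendsto' hlim fun n => ?_) bot_le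
    refine (measure_mono fun x hx => ?_).trans (hESn n)
    have hx : f x ≤ 0 := hx
    exact hx.trans (by positivity : 0 ≤ c * η ^ n)
  have hofReal {y : ℝ} (hy : 0 < y) : ENNReal.ofReal y ^ (-ε) = ENNReal.ofReal (y ^ (-ε)) :=
    ENNReal.ofReal_rpow_of_pos hy
  have hbound : ∀ᵐ x ∂μ.restrict S, ENNReal.ofReal (f x) ^ (-ε) ≤
      ENNReal.ofReal (c ^ (-ε)) +
        ∑' n : ℕ, (E n).indicator (fun _ => a * ENNReal.ofReal ((3 / 2) ^ n)) x := by
    have hae : ∀ᵐ x ∂μ.restrict S, ¬ f x ≤ 0 := by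
      rw [ae_iff]
      simpa using hnull
    filter_upwards [hae] with x hx
    have hx : 0 < f x := not_le.1 hx
    rw [hofReal hx]
    by_cases hxc : f x ≤ c
    · obtain ⟨n, hn1, hn2⟩ := exists_nat_pow_near_of_lt_one (div_pos hx hc)
        ((div_le_one hc).2 hxc) hη hη1
      have hn1 : c * η ^ (n + 1) < f x := by rwa [lt_div_iff₀ hc, mul_comm] at hn1
      have hn2 : f x ≤ c * η ^ n := by rwa [div_le_iff₀ hc, mul_comm] at hn2
      refine le_add_left (le_trans ?_ (ENNReal.le_tsum n))
      rw [Set.indicator_of_mem (by exact hn2), ← ENNReal.ofReal_mul (by positivity)]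
      refine ENNReal.ofReal_le_ofReal ?_
      calc f x ^ (-ε) ≤ (c * η ^ (n + 1)) ^ (-ε) :=
            Real.rpow_le_rpow_of_nonpos (by positivity) hn1.le (by linarith)
        _ = (c * η) ^ (-ε) * (η ^ (-ε)) ^ n := by
            rw [pow_succ', ← mul_assoc, Real.mul_rpow (by positivity) (by positivity),
              ← Real.rpow_natCast, ← Real.rpow_natCast, ← Real.rpow_mul hη.le,
              ← Real.rpow_mul hη.le, mul_comm (n : ℝ)]
        _ ≤ (c * η) ^ (-ε) * (3 / 2) ^ n := by
            gcongr
    · refine le_add_right (ENNReal.ofReal_le_ofReal ?_)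
      exact Real.rpow_le_rpow_of_nonpos hc (not_le.1 hxc).le (by linarith)
  refine (lintegral_mono_ae hbound).trans_lt ?_
  rw [lintegral_add_left measurable_const, lintegral_tsum
    fun n => (measurable_const.indicator (hE n)).aemeasurable]
  refine ENNReal.add_lt_top.2 ⟨?_, ?_⟩
  · rw [lintegral_const, Measure.restrict_apply_univ]
    exact ENNReal.mul_lt_top ENNReal.ofReal_lt_top hS.lt_top
  · calc ∑' n : ℕ, ∫⁻ x in S, (E n).indicator (fun _ => a * ENNReal.ofReal ((3 / 2) ^ n)) x ∂μ
        ≤ ∑' n : ℕ, (a * B) * ENNReal.ofReal (3 / 4) ^ n := by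
          refine ENNReal.tsum_le_tsum fun n => ?_
          rw [lintegral_indicator_const (hE n)]
          have h34 : ENNReal.ofReal (3 / 4) ^ n = ENNReal.ofReal ((3 / 2) ^ n) * 2⁻¹ ^ n := by
            have : (2⁻¹ : ℝ≥0∞) = ENNReal.ofReal (1 / 2) := by
              rw [ENNReal.ofReal_div_of_pos two_pos]; simp
            rw [this, ← ENNReal.ofReal_pow (by norm_num), ← ENNReal.ofReal_pow (by norm_num),
              ← ENNReal.ofReal_mul (by positivity), ← mul_pow]
            norm_num
          rw [h34, mul_mul_mul_comm]
          gcongr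
          exact hESn n
      _ < ∞ := by
          rw [ENNReal.tsum_mul_left]
          refine ENNReal.mul_lt_top (ENNReal.mul_lt_top ENNReal.ofReal_lt_top hB.lt_top) ?_
          rw [ENNReal.tsum_geometric]
          refine ENNReal.inv_lt_top.2 (tsub_pos_of_lt ?_)
          rw [← ENNReal.ofReal_one]
          exact (ENNReal.ofReal_lt_ofReal_iff one_pos).2 (by norm_num)

end Measure

/-! ### The topology of the group of rational points -/

section Topology

variable {F A : Type*} [NontriviallyNormedField F] [CommRing A] [HopfAlgebra F A]

lemma continuous_apply_point (a : A) : Continuous fun t : RationalPoints F A => t.ofConv a :=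
  (continuous_apply a).comp continuous_induced_dom

/-- `T(F)` is closed in the product `F ^ A`, being cut out by the equations of an algebra
homomorphism. -/
lemma isClosedEmbedding_point :
    Topology.IsClosedEmbedding fun (t : RationalPoints F A) (a : A) => t.ofConv a := by
  refine ⟨⟨⟨rfl⟩, fun s t h => ?_⟩, ?_⟩
  · exact WithConv.ext (AlgHom.ext fun a => congrFun h a)
  · have : (Set.range fun (t : RationalPoints F A) (a : A) => t.ofConv a) =
        {φ : A → F | φ 1 = 1} ∩ {φ | ∀ a b, φ (a * b) = φ a * φ b} ∩
          {φ | ∀ a b, φ (a + b) = φ a + φ b} ∩ {φ | ∀ r, φ (algebraMap F A r) = r} := by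
      ext φ
      constructor
      · rintro ⟨t, rfl⟩
        exact ⟨⟨⟨map_one t.ofConv, map_mul t.ofConv⟩, map_add t.ofConv⟩, t.ofConv.commutes⟩
      · rintro ⟨⟨⟨h1, hmul⟩, hadd⟩, halg⟩
        exact ⟨.toConv
          { toFun := φ
            map_one' := h1
            map_mul' := hmul
            map_zero' := by simpa using hadd 0 0
            map_add' := hadd
            commutes' := halg }, rfl⟩
    rw [this]
    refine ((IsClosed.inter (IsClosed.inter ?_ ?_) ?_).inter ?_)
    · exact isClosed_eq (continuous_apply _) continuous_const
    · simp only [Set.ofPred_forall]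
      exact isClosed_iInter fun a => isClosed_iInter fun b => isClosed_eq (continuous_apply _)
        ((continuous_apply a).mul (continuous_apply b))
    · simp only [Set.ofPred_forall]
      exact isClosed_iInter fun a => isClosed_iInter fun b => isClosed_eq (continuous_apply _)
        ((continuous_apply a).add (continuous_apply b))
    · simp only [Set.ofPred_forall]
      exact isClosed_iInter fun a => isClosed_eq (continuous_apply _) continuous_const

instance : T2Space (RationalPoints F A) := isClosedEmbedding_point.isEmbedding.t2Space

instance : ContinuousMul (RationalPoints F A) where
  continuous_mul := by
    refine continuous_induced_rng.2 (continuous_pi fun a => ?_)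
    have h (s t : RationalPoints F A) : (s * t).ofConv a =
        ∑ i ∈ (Coalgebra.Repr.arbitrary F a).index,
          s.ofConv ((Coalgebra.Repr.arbitrary F a).left i) *
            t.ofConv ((Coalgebra.Repr.arbitrary F a).right i) := by
      refine (AlgHom.convMul_apply s t a).trans ?_
      rw [← (Coalgebra.Repr.arbitrary F a).eq]
      simp
    simp only [Function.comp_def, h]
    exact continuous_finsetSum _ fun i _ =>
      ((continuous_apply_point _).comp continuous_fst).mul
        ((continuous_apply_point _).comp continuous_snd)

lemma isCompact_setOf_norm_le [ProperSpace F] (M : A → ℝ) :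
    IsCompact {t : RationalPoints F A | ∀ a, ‖t.ofConv a‖ ≤ M a} := by
  have := isClosedEmbedding_point.isCompact_preimage
    (isCompact_univ_pi fun a => isCompact_closedBall (0 : F) (M a)) (X := RationalPoints F A)
  convert this using 1
  ext t
  simp

/-- `T(F)` is locally compact: bounds on finitely many generators bound every regular function. -/
lemma exists_isCompact_mem_nhds_point [ProperSpace F]
    (hA : Algebra.FiniteType F A) (t₀ : RationalPoints F A) :
    ∃ S : Set (RationalPoints F A), IsCompact S ∧ S ∈ nhds t₀ := by
  obtain ⟨s, hs⟩ := hA.out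
  -- `U` bounds the values of the generators
  let U : Set (RationalPoints F A) := {t | ∀ a ∈ s, ‖t.ofConv a‖ < ‖t₀.ofConv a‖ + 1}
  have hU : IsOpen U := by
    simp only [U, Set.ofPred_forall]
    exact isOpen_biInter_finset fun a _ =>
      isOpen_lt (continuous_apply_point a).norm continuous_const
  have hbound (a : A) : ∃ M : ℝ, ∀ t ∈ U, ‖t.ofConv a‖ ≤ M := by
    have ha : a ∈ Algebra.adjoin F (s : Set A) := hs ▸ Algebra.mem_top
    induction ha using Algebra.adjoin_induction with
    | mem a ha => exact ⟨_, fun t ht => (ht a ha).le⟩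
    | algebraMap r => exact ⟨‖r‖, fun t _ => by rw [AlgHom.commutes]; rfl⟩
    | add a b _ _ ha hb =>
      obtain ⟨M, hM⟩ := ha
      obtain ⟨N, hN⟩ := hb
      exact ⟨M + N, fun t ht => by
        rw [map_add]
        exact (norm_add_le _ _).trans (add_le_add (hM t ht) (hN t ht))⟩
    | mul a b _ _ ha hb =>
      obtain ⟨M, hM⟩ := ha
      obtain ⟨N, hN⟩ := hb
      exact ⟨M * N, fun t ht => by
        rw [map_mul, norm_mul]
        exact mul_le_mul (hM t ht) (hN t ht) (norm_nonneg _) ((norm_nonneg _).trans (hM t ht))⟩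
  choose M hM using hbound
  refine ⟨_, isCompact_setOf_norm_le M, Filter.mem_of_superset (hU.mem_nhds fun a _ => ?_)
    fun t ht a => hM a t ht⟩
  exact lt_add_one _

lemma continuous_extendPoint {K : Type*} [NormedField K] [NormedAlgebra F K] (x : K ⊗[F] A) :
    Continuous fun t : RationalPoints F A =>
      extendPoint (K := K) (mapPoint (Algebra.ofId F K) t) x := by
  induction x with
  | zero => simpa using continuous_const
  | add x y hx hy =>
    simp only [map_add]
    exact hx.add hy
  | tmul c a =>
    simp only [extendPoint_tmul]
    exact continuous_const.mul ((continuous_algebraMap F K).comp (continuous_apply_point a))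

lemma characterEval_mul (χ : CharacterGroup F A) (s t : RationalPoints F A) :
    χ.eval (s * t) = χ.eval s * χ.eval t := by
  have h : mapPoint (Algebra.ofId F (AlgebraicClosure F)) (s * t : RationalPoints F A) =
      mapPoint (Algebra.ofId F (AlgebraicClosure F)) s *
        mapPoint (Algebra.ofId F (AlgebraicClosure F)) t :=
    map_mul (mapPoint (A := A) (Algebra.ofId F (AlgebraicClosure F))) s t
  exact (congrArg (charHom χ) h).trans (map_mul (charHom χ) _ _)

end Topology

/-! ### Local summability -/

section Curve

open Polynomial
open scoped Pointwise

variable {F A : Type*} [NontriviallyNormedField F] [IsUltrametricDist F] [CompleteSpace F]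

/-- The algebraic closure is normed by the spectral norm. -/
noncomputable local instance instNormedFieldClosure : NormedField (AlgebraicClosure F) :=
  spectralNorm.normedField F (AlgebraicClosure F)

noncomputable local instance instNormedAlgebraClosure : NormedAlgebra F (AlgebraicClosure F) :=
  spectralNorm.normedAlgebra F (AlgebraicClosure F)

local instance instIsUltrametricDistClosure : IsUltrametricDist (AlgebraicClosure F) :=
  IsUltrametricDist.isUltrametricDist_of_forall_norm_add_le_max_norm isNonarchimedean_spectralNorm

variable [CommRing A] [HopfAlgebra F A]

/-- The points at which all characters have absolute value `1` form a bounded set. -/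
lemma exists_bound_of_norm_charHom_eq_one (hT : IsTorus F A) :
    ∃ M : A → ℝ, ∀ t : RationalPoints F A, (∀ u : CharacterGroup F A, ‖u.eval t‖ = 1) →
      ∀ a, ‖t.ofConv a‖ ≤ M a := by
  have hc (a : A) : ∃ c : CharacterGroup F A →₀ AlgebraicClosure F,
      c.sum (fun u x => x • u.val) = (1 : AlgebraicClosure F) ⊗ₜ[F] a :=
    Finsupp.mem_span_range_iff_exists_finsupp.1 (span_groupLike_eq_top hT ▸ Submodule.mem_top)
  choose c hc using hc
  refine ⟨fun a => ∑ u ∈ (c a).support, ‖c a u‖, fun t ht a => ?_⟩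
  let T := mapPoint (Algebra.ofId F (AlgebraicClosure F)) t
  have h1 : algebraMap F (AlgebraicClosure F) (t.ofConv a) =
      ∑ u ∈ (c a).support, c a u * u.eval t := by
    have : algebraMap F (AlgebraicClosure F) (t.ofConv a) =
        extendPoint (K := AlgebraicClosure F) T (1 ⊗ₜ a) := by
      rw [extendPoint_tmul, map_one, one_mul]
      rfl
    rw [this, ← hc a, Finsupp.sum, map_sum]
    exact Finset.sum_congr rfl fun u _ => by rw [map_smul, smul_eq_mul]; rfl
  rw [← norm_algebraMap' (AlgebraicClosure F), h1]
  exact (norm_sum_le _ _).trans_eq (Finset.sum_congr rfl fun u _ => by rw [norm_mul, ht, mul_one])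

/-- The rational curve on a small ball around `0`, where it stays in a bounded subset of `T(F)` and
`χ` is a quotient `P / Q` of polynomials of absolute value `1`. -/
lemma exists_polynomial_curve (hT : IsTorus F A) {χ : CharacterGroup F A} (hχ : χ ≠ 1) :
    ∃ P Q : (AlgebraicClosure F)[X], P ≠ Q ∧ P.eval 0 = 1 ∧ Q.eval 0 = 1 ∧
      ∃ r : ℝ, 0 < r ∧ ∃ M : A → ℝ, ∀ x : F, ‖x‖ ≤ r →
        ‖P.eval (algebraMap F (AlgebraicClosure F) x)‖ = 1 ∧
        ‖Q.eval (algebraMap F (AlgebraicClosure F) x)‖ = 1 ∧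
        ∃ t : RationalPoints F A, (∀ a, ‖t.ofConv a‖ ≤ M a) ∧
          χ.eval t * Q.eval (algebraMap F (AlgebraicClosure F) x) =
            P.eval (algebraMap F (AlgebraicClosure F) x) := by
  have : Infinite F := NontriviallyNormedField.infinite F
  obtain ⟨M, hM⟩ := exists_bound_of_norm_charHom_eq_one hT
  obtain ⟨ι, _, β, N, hinj, hβ0, ⟨i₀, hi₀⟩, ht⟩ := exists_rational_curve hT hχ
  let lin (i : ι) : (AlgebraicClosure F)[X] := 1 - X * C (β i)
  have hlin (i : ι) (y : AlgebraicClosure F) : (lin i).eval y = 1 - y * β i := by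
    simp [lin, mul_comm y]
  have heval (e : ι → ℕ) (y : AlgebraicClosure F) :
      (∏ i, lin i ^ e i).eval y = ∏ i, (1 - y * β i) ^ e i := by
    simp [eval_prod, hlin]
  -- at the inverse of `β i₀` only the factor with index `i₀` vanishes
  have hroot (e : ι → ℕ) : (∏ i, lin i ^ e i).eval (β i₀)⁻¹ = 0 ↔ e i₀ ≠ 0 := by
    rw [heval, Finset.prod_eq_zero_iff]
    constructor
    · rintro ⟨i, -, hi⟩
      obtain ⟨hi, he⟩ := pow_eq_zero_iff'.1 hi
      have : β i = β i₀ := by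
        rw [sub_eq_zero, eq_comm, inv_mul_eq_one₀ (hβ0 _)] at hi
        exact hi.symm
      rwa [← hinj this]
    · intro h
      exact ⟨i₀, Finset.mem_univ _, by rw [inv_mul_cancel₀ (hβ0 _), sub_self, zero_pow h]⟩
  refine ⟨∏ i, lin i ^ (N i χ).toNat, ∏ i, lin i ^ (-N i χ).toNat, ?_, ?_, ?_,
    (1 + ∑ i, ‖β i‖)⁻¹, by positivity, M, fun x hx => ?_⟩
  · intro h
    have h1 := hroot fun i => (N i χ).toNat
    have h2 := hroot fun i => (-N i χ).toNat
    rw [h, h2] at h1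
    omega
  · simp [heval]
  · simp [heval]
  have hnorm (i : ι) : ‖1 - algebraMap F (AlgebraicClosure F) x * β i‖ = 1 := by
    have hlt : ‖algebraMap F (AlgebraicClosure F) x * β i‖ < 1 := by
      rw [norm_mul, norm_algebraMap']
      have h1 : ‖β i‖ ≤ ∑ i, ‖β i‖ :=
        Finset.single_le_sum (f := fun i => ‖β i‖) (fun _ _ => norm_nonneg _) (Finset.mem_univ i)
      calc ‖x‖ * ‖β i‖ ≤ (1 + ∑ i, ‖β i‖)⁻¹ * ∑ i, ‖β i‖ := by gcongr
        _ < 1 := by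
          rw [inv_mul_lt_one₀ (by positivity)]
          exact lt_one_add _
    rw [sub_eq_add_neg, IsUltrametricDist.norm_add_eq_max_of_norm_ne_norm]
    · simpa using hlt.le
    · simpa using hlt.ne'
  have hne (i : ι) : 1 - algebraMap F (AlgebraicClosure F) x * β i ≠ 0 := by
    rw [← norm_ne_zero_iff, hnorm]
    exact one_ne_zero
  obtain ⟨t', ht'⟩ := ht x hne
  let t : RationalPoints F A := t'
  have ht (u : CharacterGroup F A) :
      u.eval t = ∏ i, (1 - algebraMap F (AlgebraicClosure F) x * β i) ^ N i u := ht' u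
  refine ⟨?_, ?_, t, hM t fun u => ?_, ?_⟩
  · simp [heval, hnorm, norm_prod]
  · simp [heval, hnorm, norm_prod]
  · simp [ht, hnorm, norm_prod]
  · rw [ht, heval, heval, ← Finset.prod_mul_distrib]
    refine Finset.prod_congr rfl fun i _ => ?_
    rw [← zpow_natCast, ← zpow_natCast, ← zpow_add₀ (hne i)]
    congr 1
    omega

lemma continuous_eval (χ : CharacterGroup F A) :
    Continuous fun t : RationalPoints F A => χ.eval t :=
  continuous_extendPoint χ.val

/-- Geometric decay of the measure of `{|χ - 1| ≤ c η ^ n}` on compact sets, with constants `c` and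
`η` that do not depend on the measure or on the compact set. -/
lemma exists_measure_sublevel_le [ProperSpace F] (hT : IsTorus F A) {χ : CharacterGroup F A}
    (hχ : χ ≠ 1) :
    ∃ c η : ℝ, 0 < c ∧ 0 < η ∧ η < 1 ∧ ∀ (μ : Measure (RationalPoints F A)) [μ.IsMulLeftInvariant]
      [IsFiniteMeasureOnCompacts μ] (S : Set (RationalPoints F A)), IsCompact S →
        ∃ B : ℝ≥0∞, B ≠ ∞ ∧ ∀ n : ℕ, μ (S ∩ {t | ‖χ.eval t - 1‖ ≤ c * η ^ n}) ≤ B * 2⁻¹ ^ n := by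
  classical
  obtain ⟨P, Q, hPQ, hP0, hQ0, r, hr, M, hcurve⟩ := exists_polynomial_curve hT hχ
  obtain ⟨ϖ, hϖ0, hϖ⟩ := NormedField.exists_norm_lt F (lt_min hr one_pos)
  obtain ⟨hϖr, hϖ1⟩ := lt_min_iff.1 hϖ
  have hϖ' : ϖ ≠ 0 := norm_pos_iff.1 hϖ0
  let φ := algebraMap F (AlgebraicClosure F)
  have hφ (x : F) : ‖φ x‖ = ‖x‖ := norm_algebraMap' _ x
  obtain ⟨y, hyr, hy⟩ : ∃ y : F, ‖y‖ ≤ ‖ϖ‖ ∧ P.eval (φ y) ≠ Q.eval (φ y) := by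
    by_contra! h
    refine hPQ (eq_of_infinite_eval_eq P Q ?_)
    refine (Set.infinite_range_of_injective (f := fun n : ℕ => φ (ϖ ^ (n + 1))) ?_).mono ?_
    · intro a b hab
      have hab := congrArg norm (φ.injective hab)
      rw [norm_pow, norm_pow] at hab
      exact Nat.succ_injective (pow_right_injective₀ hϖ0 hϖ1.ne hab)
    · rintro _ ⟨n, rfl⟩
      exact h _ (by rw [norm_pow]; exact pow_le_of_le_one hϖ0.le hϖ1.le n.succ_ne_zero)
  set κ := ‖P.eval (φ y) - Q.eval (φ y)‖ with hκ
  have hκ0 : 0 < κ := norm_pos_iff.2 (sub_ne_zero.2 hy)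
  -- adding `1` makes the degree bound positive, so that `‖ϖ‖ ^ m < 1`
  set m := max P.natDegree Q.natDegree + 1
  have hPm : P.natDegree ≤ m := (le_max_left _ _).trans (Nat.le_succ _)
  have hQm : Q.natDegree ≤ m := (le_max_right _ _).trans (Nat.le_succ _)
  refine ⟨κ / 2, ‖ϖ‖ ^ m, half_pos hκ0, pow_pos hϖ0 m,
    pow_lt_one₀ hϖ0.le hϖ1 (Nat.succ_ne_zero _), fun μ _ _ S hS => ?_⟩
  set T : Set (RationalPoints F A) := {t | ∀ a, ‖t.ofConv a‖ ≤ M a}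
  have hTS : IsCompact (T * S) := (isCompact_setOf_norm_le M).mul hS
  refine ⟨m * μ (T * S), ENNReal.mul_ne_top (ENNReal.natCast_ne_top m) hTS.measure_ne_top,
    fun n => ?_⟩
  set E := S ∩ {t : RationalPoints F A | ‖χ.eval t - 1‖ ≤ κ / 2 * (‖ϖ‖ ^ m) ^ n}
  have hE : MeasurableSet E := hS.measurableSet.inter
    (isClosed_le ((continuous_eval χ).sub continuous_const).norm continuous_const).measurableSet
  obtain ⟨D, hDcard, hD, hsep⟩ := exists_separated_finset hϖ' hϖ1 n
  have hDr (x : F) (hx : x ∈ D) : ‖x‖ ≤ r := (hD x hx).trans hϖr.le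
  choose! γ hγ using fun x (hx : ‖x‖ ≤ r) => (hcurve x hx).2.2
  have hcount := card_mul_measure_le μ hE D γ (C := T * S)
    (fun x hx g hg => Set.mul_mem_mul (hγ x (hDr x hx)).1 hg.1) m fun g D' hD' hg => ?_
  · rw [hDcard] at hcount
    have h2 : ((2 ^ n : ℕ) : ℝ≥0∞) = 2 ^ n := by push_cast; rfl
    rw [h2] at hcount
    rw [← ENNReal.inv_pow, ← div_eq_mul_inv, ENNReal.le_div_iff_mul_le (by simp) (by simp),
      mul_comm]
    exact hcount
  · rw [← Finset.card_image_of_injective D' φ.injective]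
    refine card_le_of_norm_sub_mul_le hPm hQm hP0 hQ0 (y := φ y)
      (by rw [hφ]; exact hyr.trans hϖ1.le) (hcurve y (hyr.trans hϖr.le)).2.1.le
      (ρ := ‖ϖ‖ ^ n) (δ := κ / 2 * (‖ϖ‖ ^ m) ^ n) (by positivity) (by positivity) ?_ ?_ ?_
      (χ.eval g) ?_
    · rw [← hκ, ← pow_mul, ← pow_mul, mul_comm n m]
      exact mul_lt_mul_of_pos_right (half_lt_self hκ0) (by positivity)
    · intro x hx
      obtain ⟨x, hxD, rfl⟩ := Finset.mem_image.1 hx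
      rw [hφ]
      exact (hD x (hD' hxD)).trans hϖ1.le
    · intro x hx x' hx' hne
      obtain ⟨x, hxD, rfl⟩ := Finset.mem_image.1 hx
      obtain ⟨x', hxD', rfl⟩ := Finset.mem_image.1 hx'
      rw [← map_sub, hφ]
      exact hsep x (hD' hxD) x' (hD' hxD') fun h => hne (h ▸ rfl)
    · intro x hx
      obtain ⟨x, hxD, rfl⟩ := Finset.mem_image.1 hx
      have hxr := hDr x (hD' hxD)
      -- `χ(g) = χ(γ x) χ(e)` with `e = (γ x)⁻¹ g`, and `P x = χ(γ x) Q x`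
      have hgx : χ.eval g = χ.eval (γ x) * χ.eval ((γ x)⁻¹ * g) := by
        rw [← characterEval_mul, mul_inv_cancel_left]
      have : P.eval (φ x) - χ.eval g * Q.eval (φ x) =
          -(P.eval (φ x) * (χ.eval ((γ x)⁻¹ * g) - 1)) := by
        rw [hgx, ← (hγ x hxr).2]
        ring
      rw [this, norm_neg, norm_mul, (hcurve x hxr).1, one_mul]
      exact (hg x hxD).2

theorem exists_locallyIntegrable [ProperSpace F] (hT : IsTorus F A) {χ : CharacterGroup F A}
    (hχ : χ ≠ 1) :
    ∃ ε : ℝ, 0 < ε ∧ ∀ μ : Measure (RationalPoints F A), μ.IsHaarMeasure →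
      LocallyIntegrable (fun t : RationalPoints F A =>
        ENNReal.ofReal (spectralNorm F (AlgebraicClosure F) (χ.eval t - 1)) ^ (-ε)) μ := by
  obtain ⟨c, η, hc, hη, hη1, h⟩ := exists_measure_sublevel_le hT hχ
  have hlog : Real.log η < 0 := Real.log_neg hη hη1
  have hlog32 : 0 < Real.log (3 / 2) := Real.log_pos (by norm_num)
  -- this exponent satisfies `η ^ (-ε) = 3 / 2`
  have hε : 0 < Real.log (3 / 2) / -Real.log η := div_pos hlog32 (neg_pos.2 hlog)
  refine ⟨_, hε, fun μ hμ t₀ => ?_⟩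
  obtain ⟨S, hS, hSt⟩ := exists_isCompact_mem_nhds_point hT.finiteType t₀
  obtain ⟨B, hB, hSB⟩ := h μ S hS
  have hmeas : Measurable fun t : RationalPoints F A => ‖χ.eval t - 1‖ :=
    ((continuous_eval χ).sub continuous_const).norm.measurable
  refine ⟨S, hSt, ?_, ?_⟩
  · exact (hmeas.ennreal_ofReal.pow_const _).aestronglyMeasurable
  · refine setLIntegral_rpow_neg_lt_top hS.measure_ne_top hmeas hc hη hη1 hε ?_ hB hSB
    have : Real.log η * -(Real.log (3 / 2) / -Real.log η) = Real.log (3 / 2) := by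
      field_simp [hlog.ne]
    rw [Real.rpow_def_of_pos hη, this, Real.exp_log (by norm_num)]

end Curve

end AlgebraicTorus

/-- Here `F` is a non-archimedean local field, `spectralNorm F (AlgebraicClosure F)` is the unique
extension of its absolute value to the algebraic closure, and the function `|χ(t) - 1| ^ (-ε)` is
`ℝ≥0∞`-valued, so it equals `∞` where `χ(t) = 1`. -/
theorem mainTheorem11 {F : Type*} [NontriviallyNormedField F] [IsUltrametricDist F]
    [LocallyCompactSpace F] {A : Type*} [CommRing A] [HopfAlgebra F A] (hT : IsTorus F A)
    (χ : CharacterGroup F A) (hχ : χ ≠ 1) :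
    ∃ ε : ℝ, 0 < ε ∧ ∀ μ : Measure (RationalPoints F A), μ.IsHaarMeasure →
      LocallyIntegrable (fun t : RationalPoints F A =>
        ENNReal.ofReal (spectralNorm F (AlgebraicClosure F) (χ.eval t - 1)) ^ (-ε)) μ := by
  have : ProperSpace F := ProperSpace.of_locallyCompactSpace F
  exact AlgebraicTorus.exists_locallyIntegrable hT hχ
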